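/- Let $G$ be a finite connected simple graph with at least one edge, with maximum vertex degree $\Delta(G)$, and let $\Phi=(G,\varphi)$ be a $\mathbb{T}$-gain graph on $G$, i.e. $\varphi$ assigns to each oriented edge $\overrightarrow{e_{p,q}}$ of $G$ (each edge being taken in both orientations) a complex number of modulus $1$ with $\varphi(\overrightarrow{e_{q,p}})=\varphi(\overrightarrow{e_{p,q}})^{-1}$. Let $A(\Phi)$ be the Hermitian matrix with $(p,q)$ entry $\varphi(\overrightarrow{e_{p,q}})$ if $v_p\sim v_q$ and $0$ otherwise, let $|A(\Phi)|=(A(\Phi)A(\Phi)^*)^{1/2}$ (positive semidefinite square root), and let $\mathcal{E}_\Phi(v_i)=|A(\Phi)|_{ii}$ be the energy of the vertex $v_i$, whose degree is $d_i$. Then $$\mathcal{E}_\Phi(v_i)\ \ge\ \frac{d_i}{\Delta(G)}\qquad\text{for every vertex } v_i .$$ Moreover, for each vertex $v_i$, equality $\mathcal{E}_\Phi(v_i)=d_i/\Delta(G)$ holds if and only if $\Phi\sim(K_{d,d},1)$ for some $d$; that is, for some $d$ there is an isomorphism of $G$ with the complete bipartite graph $K_{d,d}$ under which $\Phi$ is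 switching equivalent to the gain graph all of whose gains are $1$. (In particular, equality holds at one vertex if and only if it holds at every vertex.) Here two $\mathbb{T}$-gain graphs $\Phi,\Phi'$ on the same graph are switching equivalent if $A(\Phi')=UA(\Phi)U^*$ for some unitary diagonal matrix $U$. -/

import Mathlib

open scoped MatrixOrder ComplexOrder

/-- A complex unit gain function on a simple graph `G`: a map from the oriented edges (darts) of `G`
to the unit circle whose value on a reversed oriented edge is the inverse.
The pair of `G` and a `UnitGain G` is a `𝕋`-gain graph. -/
structure UnitGain {V : Type*} (G : SimpleGraph V) where
  /-- the gain of an oriented edge -/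
  gain : G.Dart → Circle
  gain_symm : ∀ d : G.Dart, gain d.symm = (gain d)⁻¹

namespace UnitGain

/-- The adjacency matrix `A(Φ)` of the gain graph `Φ = (G, φ)`. -/
noncomputable def adjMatrix {V : Type*} {G : SimpleGraph V} [DecidableRel G.Adj]
    (φ : UnitGain G) : Matrix V V ℂ :=
  Matrix.of fun p q => if h : G.Adj p q then (φ.gain ⟨(p, q), h⟩ : ℂ) else 0

theorem adjMatrix_isHermitian {V : Type*} {G : SimpleGraph V} [DecidableRel G.Adj]
    (φ : UnitGain G) : φ.adjMatrix.IsHermitian := by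
  ext p q
  by_cases h : G.Adj p q
  · have hs : φ.gain ⟨(q, p), h.symm⟩ = (φ.gain ⟨(p, q), h⟩)⁻¹ := φ.gain_symm ⟨(p, q), h⟩
    simp only [adjMatrix, Matrix.conjTranspose_apply, Matrix.of_apply, h, h.symm, dif_pos, hs,
      Circle.coe_inv_eq_conj]
    exact star_star _
  · have h' : ¬ G.Adj q p := fun hq => h hq.symm
    simp [adjMatrix, Matrix.conjTranspose_apply, h, h']

/-- The constant gain `1`; `(G, 1)` is the underlying graph seen as a gain graph. -/
noncomputable def one {V : Type*} (G : SimpleGraph V) : UnitGain G where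
  gain _ := 1
  gain_symm _ := by simp

/-- Transport of a gain function along an identification of the underlying graphs. -/
def pullback {V W : Type*} {G : SimpleGraph V} {H : SimpleGraph W} (e : G ≃g H)
    (ψ : UnitGain H) : UnitGain G where
  gain d := ψ.gain (e.toHom.mapDart d)
  gain_symm d := ψ.gain_symm (e.toHom.mapDart d)

/-- Switching equivalence of two gain functions on the same graph:
`A(Φ') = U A(Φ) U*` for some unitary diagonal matrix `U`. -/
def SwitchingEquiv {V : Type*} [Fintype V] [DecidableEq V] {G : SimpleGraph V}
    [DecidableRel G.Adj] (φ φ' : UnitGain G) : Prop :=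
  ∃ U : Matrix V V ℂ, U.IsDiag ∧ U ∈ Matrix.unitaryGroup V ℂ ∧
    φ'.adjMatrix = U * φ.adjMatrix * U.conjTranspose

/-- `Φ ∼ Ψ` for gain graphs on possibly different vertex sets: after an identification of the two
underlying graphs, `Φ` and `Ψ` are switching equivalent. -/
def SwitchingIso {V W : Type*} [Fintype V] [DecidableEq V] {G : SimpleGraph V}
    [DecidableRel G.Adj] {H : SimpleGraph W} (φ : UnitGain G) (ψ : UnitGain H) : Prop :=
  ∃ e : G ≃g H, SwitchingEquiv φ (ψ.pullback e)

/-- `|A(Φ)| = (A(Φ) A(Φ)*)^{1/2}`, with the positive semidefinite square root. -/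
noncomputable def absAdjMatrix {V : Type*} [Fintype V] [DecidableEq V] {G : SimpleGraph V}
    [DecidableRel G.Adj] (φ : UnitGain G) : Matrix V V ℂ :=
  CFC.sqrt (φ.adjMatrix * φ.adjMatrix.conjTranspose)

theorem absAdjMatrix_posSemidef {V : Type*} [Fintype V] [DecidableEq V] {G : SimpleGraph V}
    [DecidableRel G.Adj] (φ : UnitGain G) : φ.absAdjMatrix.PosSemidef :=
  Matrix.nonneg_iff_posSemidef.mp (CFC.sqrt_nonneg _)

theorem absAdjMatrix_mul_self {V : Type*} [Fintype V] [DecidableEq V] {G : SimpleGraph V}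
    [DecidableRel G.Adj] (φ : UnitGain G) :
    φ.absAdjMatrix * φ.absAdjMatrix = φ.adjMatrix * φ.adjMatrix.conjTranspose :=
  CFC.sqrt_mul_sqrt_self _
    (Matrix.nonneg_iff_posSemidef.mpr (Matrix.posSemidef_self_mul_conjTranspose φ.adjMatrix))

/-- The energy of the vertex `i`: the diagonal entry `|A(Φ)|_{ii}`, which is a real number
(see `coe_vertexEnergy`). -/
noncomputable def vertexEnergy {V : Type*} [Fintype V] [DecidableEq V] {G : SimpleGraph V}
    [DecidableRel G.Adj] (φ : UnitGain G) (i : V) : ℝ :=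
  (φ.absAdjMatrix i i).re

theorem coe_vertexEnergy {V : Type*} [Fintype V] [DecidableEq V] {G : SimpleGraph V}
    [DecidableRel G.Adj] (φ : UnitGain G) (i : V) :
    (φ.vertexEnergy i : ℂ) = φ.absAdjMatrix i i :=
  φ.absAdjMatrix_posSemidef.isHermitian.coe_re_apply_self i

end UnitGain

open Matrix Finset

/-! Write `A` for the adjacency matrix and `D` for the maximum degree. Each row of `A` has at most
`D` nonzero entries, all unimodular, so the spectrum lies in `[-D, D]` and `D|A| - A²` is positive
semidefinite. Its `i`-th diagonal entry is `D · E(i) - deg i`, which gives the bound. If that entry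
vanishes, the `i`-th column of `D|A| - A²` vanishes, whence `A³eᵢ = D²Aeᵢ`
(`cube_apply_of_diag_eq_zero`). Read at a neighbour `j` of `i`, this says that the gains of the
walks `j, k, l, i` sum to `D²` times a unit. There are at most `deg j · deg i ≤ D²` such walks, so
all candidates occur and all gains agree (`walk_of_cube_eq`); connectedness then forces `K_{D,D}`
with a switchable gain. Conversely, `A³ = d²A` on `K_{d,d}`, so `|A| = A²/d`. -/

/-- A real number in the spectrum of a square matrix is bounded by a common bound of the
absolute row sums. -/
theorem Matrix.abs_le_of_mem_spectrum_of_row_sum_le {n : Type*} [Fintype n] [DecidableEq n]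
    {A : Matrix n n ℂ} {D t : ℝ} (hrow : ∀ p, ∑ q, ‖A p q‖ ≤ D) (ht : t ∈ spectrum ℝ A) :
    |t| ≤ D := by
  have h1 : (algebraMap ℝ ℂ t) ∈ spectrum ℂ A := spectrum.algebraMap_mem ℂ ht
  rw [← Matrix.spectrum_toLin', ← Module.End.hasEigenvalue_iff_mem_spectrum] at h1
  obtain ⟨k, hk⟩ := eigenvalue_mem_ball h1
  rw [mem_closedBall_iff_norm] at hk
  have h2 : ‖(algebraMap ℝ ℂ t)‖ ≤ ‖A k k‖ + ∑ j ∈ univ.erase k, ‖A k j‖ := by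
    have := norm_sub_norm_le (algebraMap ℝ ℂ t) (A k k)
    linarith
  rw [Finset.add_sum_erase _ (fun j => ‖A k j‖) (mem_univ k)] at h2
  have h3 : ‖(algebraMap ℝ ℂ t)‖ = |t| := by simp
  exact h3 ▸ h2.trans (hrow k)

/-- If the absolute row sums of a Hermitian matrix `A` are at most `D`, then `A² ≤ D |A|`. -/
theorem Matrix.IsHermitian.posSemidef_smul_abs_sub {n : Type*} [Fintype n] [DecidableEq n]
    {A : Matrix n n ℂ} (hA : A.IsHermitian) {D : ℝ} (hrow : ∀ p, ∑ q, ‖A p q‖ ≤ D) :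
    (D • CFC.sqrt (A * Aᴴ) - A * A).PosSemidef := by
  have hs : IsSelfAdjoint A := hA
  have h1 : CFC.sqrt (A * Aᴴ) = cfc (fun t : ℝ => ‖t‖) A := by
    rw [← CFC.abs_eq_cfc_norm A hs, CFC.abs, hs.star_eq, hA.eq]
  have h2 : D • CFC.sqrt (A * Aᴴ) - A * A = cfc (fun t : ℝ => D * ‖t‖ - t * t) A := by
    rw [h1, cfc_sub _ _ A, cfc_const_mul D _ A, cfc_mul _ _ A, cfc_id' ℝ A]
  rw [h2, ← Matrix.nonneg_iff_posSemidef]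
  refine cfc_nonneg fun t ht => ?_
  have h3 := abs_le_of_mem_spectrum_of_row_sum_le hrow ht
  rw [Real.norm_eq_abs]
  -- `D|t| - t² = |t|(D - |t|)`.
  nlinarith [abs_nonneg t, abs_mul_abs_self t]

/-- If the `i`-th diagonal entry of `D |A| - A²` vanishes, where the absolute row sums of the
Hermitian matrix `A` are at most `D`, then the `i`-th columns of `A³` and `D² A` agree. -/
theorem Matrix.IsHermitian.cube_apply_of_diag_eq_zero {n : Type*} [Fintype n] [DecidableEq n]
    {A : Matrix n n ℂ} (hA : A.IsHermitian) {D : ℝ} (hrow : ∀ p, ∑ q, ‖A p q‖ ≤ D) {i : n}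
    (hi : (D • CFC.sqrt (A * Aᴴ) - A * A) i i = 0) (j : n) :
    (A * (A * A)) j i = (D : ℂ) ^ 2 * A j i := by
  set P := CFC.sqrt (A * Aᴴ) with hP
  have hPP : P * P = A * A := by
    have := CFC.sqrt_mul_sqrt_self _
      (Matrix.nonneg_iff_posSemidef.mpr (Matrix.posSemidef_self_mul_conjTranspose A))
    rw [← hP] at this
    rw [this, hA.eq]
  set e : n → ℂ := Pi.single i 1 with he
  have h0 : (D • P - A * A) *ᵥ e = 0 := by
    rw [← (hA.posSemidef_smul_abs_sub hrow).dotProduct_mulVec_zero_iff]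
    simp [he, hi, ← hP]
  have h1 : (A * A) *ᵥ e = (D : ℂ) • (P *ᵥ e) := by
    rw [sub_mulVec, sub_eq_zero] at h0
    rw [← h0, smul_mulVec]
    ext k
    simp
  have h2 : (A * A) *ᵥ ((A * A) *ᵥ e) = (D : ℂ) ^ 2 • ((A * A) *ᵥ e) := by
    have h3 : P *ᵥ ((A * A) *ᵥ e) = (A * A) *ᵥ (P *ᵥ e) := by
      rw [← hPP]; simp only [mulVec_mulVec, Matrix.mul_assoc]
    have h4 : P *ᵥ (P *ᵥ e) = (A * A) *ᵥ e := by rw [mulVec_mulVec, hPP]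
    have h5 : (A * A) *ᵥ (P *ᵥ e) = (D : ℂ) • ((A * A) *ᵥ e) := by
      rw [← h3, h1, mulVec_smul, h4, h1]
    conv_lhs => rw [h1]
    rw [mulVec_smul, h5, smul_smul, sq]
  -- `A` may be singular, so only one factor is cancelled: `AᴴA` and `A` have the same kernel.
  have h3 : (Aᴴ * A) *ᵥ ((A * A) *ᵥ e - (D : ℂ) ^ 2 • e) = 0 := by
    rw [hA.eq, mulVec_sub, h2, mulVec_smul, sub_self]
  rw [conjTranspose_mul_self_mulVec_eq_zero, mulVec_sub, mulVec_mulVec, mulVec_smul,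
    sub_eq_zero] at h3
  simpa [he] using congrFun h3 j

/-- The square root of `A A*` for a Hermitian `A` with `A³ = d² A`, `d > 0`, is `d⁻¹ A²`. -/
theorem Matrix.IsHermitian.sqrt_eq_of_cube {n : Type*} [Fintype n] [DecidableEq n]
    {A : Matrix n n ℂ} (hA : A.IsHermitian) {d : ℝ} (hd : 0 < d)
    (h : A * A * A = (d ^ 2) • A) : CFC.sqrt (A * Aᴴ) = d⁻¹ • (A * A) := by
  have hpos : (A * A).PosSemidef := by
    simpa [hA.eq] using Matrix.posSemidef_self_mul_conjTranspose A
  refine CFC.sqrt_unique ?_ ?_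
  · rw [smul_mul_smul_comm, ← Matrix.mul_assoc, h, hA.eq, smul_mul_assoc, smul_smul]
    have : d⁻¹ * d⁻¹ * d ^ 2 = 1 := by field_simp
    rw [this, one_smul]
  · exact smul_nonneg (inv_nonneg.mpr hd.le) (Matrix.nonneg_iff_posSemidef.mpr hpos)

/-! ### Complete bipartite graphs -/

/-- A graph whose edges are the pairs separated by `X`, where `X` and its complement both
have `d` elements, is a complete bipartite graph. -/
theorem SimpleGraph.nonempty_iso_completeBipartiteGraph {V : Type*} [Fintype V] [DecidableEq V]
    {G : SimpleGraph V} {X : Finset V} {d : ℕ}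
    (hadj : ∀ p q, G.Adj p q ↔ (p ∈ X ∧ q ∉ X ∨ p ∉ X ∧ q ∈ X))
    (hX : X.card = d) (hX' : Xᶜ.card = d) :
    Nonempty (G ≃g completeBipartiteGraph (Fin d) (Fin d)) := by
  have e₁ : {p // p ∈ X} ≃ Fin d := Fintype.equivFinOfCardEq (by simpa using hX)
  have e₂ : {p // p ∉ X} ≃ Fin d := Fintype.equivFinOfCardEq (by
    rw [← hX', Fintype.card_subtype]
    congr 1
    ext p
    simp)
  let e : V ≃ Fin d ⊕ Fin d := (Equiv.sumCompl (· ∈ X)).symm.trans (e₁.sumCongr e₂)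
  refine ⟨⟨e, ?_⟩⟩
  intro p q
  have hl : ∀ p, (e p).isLeft = true ↔ p ∈ X := by
    intro p
    by_cases hp : p ∈ X
    · simp [e, Equiv.sumCompl_symm_apply_of_pos, hp]
    · simp [e, Equiv.sumCompl_symm_apply_of_neg, hp]
  have hr : ∀ p, (e p).isRight = true ↔ p ∉ X := by
    intro p
    simp [← hl p]
  rw [completeBipartiteGraph_adj, hl, hl, hr, hr, hadj]

theorem SimpleGraph.degree_eq_of_iso_completeBipartiteGraph {V : Type*} [Fintype V]
    {G : SimpleGraph V} [DecidableRel G.Adj] {d : ℕ}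
    (e : G ≃g completeBipartiteGraph (Fin d) (Fin d)) (p : V) : G.degree p = d := by
  classical
  rw [← e.degree_eq p, ← SimpleGraph.card_neighborFinset_eq_degree,
    SimpleGraph.neighborFinset_eq_filter, Finset.card_filter, Fintype.sum_sum_type]
  rcases e p <;> simp

/-! ### Entries of the adjacency matrix and gains of walks -/

namespace UnitGain

section

variable {V : Type*} {G : SimpleGraph V} [DecidableRel G.Adj] (φ : UnitGain G)

theorem adjMatrix_apply_of_not_adj {p q : V} (h : ¬ G.Adj p q) : φ.adjMatrix p q = 0 := by
  simp [adjMatrix, h]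

theorem norm_adjMatrix_of_adj {p q : V} (h : G.Adj p q) : ‖φ.adjMatrix p q‖ = 1 := by
  simp only [adjMatrix, Matrix.of_apply, h, dif_pos]
  exact Circle.norm_coe _

theorem norm_adjMatrix (p q : V) : ‖φ.adjMatrix p q‖ = if G.Adj p q then 1 else 0 := by
  split_ifs with h
  · exact φ.norm_adjMatrix_of_adj h
  · rw [φ.adjMatrix_apply_of_not_adj h, norm_zero]

theorem star_adjMatrix (p q : V) : star (φ.adjMatrix p q) = φ.adjMatrix q p :=
  φ.adjMatrix_isHermitian.apply q p

theorem adjMatrix_mul_swap {p q : V} (h : G.Adj p q) :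
    φ.adjMatrix p q * φ.adjMatrix q p = 1 := by
  rw [← φ.star_adjMatrix p q]
  have := Complex.mul_conj' (φ.adjMatrix p q)
  rw [φ.norm_adjMatrix_of_adj h] at this
  simpa using this

variable [Fintype V]

theorem sum_norm_adjMatrix (p : V) : ∑ q, ‖φ.adjMatrix p q‖ = G.degree p := by
  simp only [norm_adjMatrix, sum_boole]
  rw [← G.card_neighborFinset_eq_degree, G.neighborFinset_eq_filter]

theorem sum_norm_adjMatrix_le (p : V) : ∑ q, ‖φ.adjMatrix p q‖ ≤ (G.maxDegree : ℝ) := by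
  rw [φ.sum_norm_adjMatrix]
  exact_mod_cast G.degree_le_maxDegree p

theorem adjMatrix_sq_diag (p : V) : (φ.adjMatrix * φ.adjMatrix) p p = G.degree p := by
  have h : ∀ q, φ.adjMatrix p q * φ.adjMatrix q p = if G.Adj p q then 1 else 0 := by
    intro q
    split_ifs with h
    · exact φ.adjMatrix_mul_swap h
    · rw [φ.adjMatrix_apply_of_not_adj h, zero_mul]
  rw [Matrix.mul_apply]
  simp only [h, sum_boole]
  rw [← G.card_neighborFinset_eq_degree, G.neighborFinset_eq_filter]

theorem smul_absAdjMatrix_sub_diag [DecidableEq V] (D : ℝ) (i : V) :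
    (D • CFC.sqrt (φ.adjMatrix * φ.adjMatrixᴴ) - φ.adjMatrix * φ.adjMatrix) i i =
      ((D * φ.vertexEnergy i - G.degree i : ℝ) : ℂ) := by
  have h : CFC.sqrt (φ.adjMatrix * φ.adjMatrixᴴ) i i = φ.vertexEnergy i :=
    (φ.coe_vertexEnergy i).symm
  rw [Matrix.sub_apply, Matrix.smul_apply, h, φ.adjMatrix_sq_diag]
  simp

theorem degree_le_maxDegree_mul_vertexEnergy [DecidableEq V] (i : V) :
    (G.degree i : ℝ) ≤ G.maxDegree * φ.vertexEnergy i := by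
  have h := (φ.adjMatrix_isHermitian.posSemidef_smul_abs_sub
    φ.sum_norm_adjMatrix_le).diag_nonneg (i := i)
  rw [φ.smul_absAdjMatrix_sub_diag, Complex.zero_le_real] at h
  linarith

/-- In the equality case every walk of length three from `j` to the neighbour `i` can be closed
up, and its gain is the gain of the edge from `j` to `i`. -/
theorem walk_of_cube_eq {i j : V} (hij : G.Adj j i)
    (hcube : (φ.adjMatrix * (φ.adjMatrix * φ.adjMatrix)) j i =
      ((G.maxDegree : ℝ) : ℂ) ^ 2 * φ.adjMatrix j i) :
    G.degree i = G.maxDegree ∧ G.degree j = G.maxDegree ∧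
      ∀ k l, G.Adj j k → G.Adj l i → G.Adj k l ∧
        φ.adjMatrix j k * φ.adjMatrix k l * φ.adjMatrix l i = φ.adjMatrix j i := by
  set A := φ.adjMatrix with hAdef
  set D := G.maxDegree with hD
  -- Gain of the closed walk `i, j, k, l, i`; the factor `A i j` normalises the common value to `1`.
  let t : V × V → ℂ := fun x => A i j * (A j x.1 * A x.1 x.2 * A x.2 i)
  have hle : ∀ p q, ‖A p q‖ ≤ 1 := fun p q => by
    rw [hAdef, norm_adjMatrix]; split_ifs <;> norm_num
  have htle : ∀ x, ‖t x‖ ≤ 1 := fun x => by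
    simp only [t, norm_mul]
    exact mul_le_one₀ (hle _ _) (by positivity) (mul_le_one₀
      (mul_le_one₀ (hle _ _) (norm_nonneg _) (hle _ _)) (norm_nonneg _) (hle _ _))
  have hsum : ∑ x ∈ G.neighborFinset j ×ˢ G.neighborFinset i, t x = (D : ℂ) ^ 2 := by
    have h1 : ∑ x ∈ G.neighborFinset j ×ˢ G.neighborFinset i, t x =
        ∑ x : V × V, t x := by
      refine Finset.sum_subset (subset_univ _) fun x _ hx => ?_
      rw [mem_product, G.mem_neighborFinset, G.mem_neighborFinset, not_and_or] at hx
      rcases hx with hx | hx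
      · simp [t, hAdef, φ.adjMatrix_apply_of_not_adj hx]
      · simp [t, hAdef, φ.adjMatrix_apply_of_not_adj (fun h => hx h.symm)]
    have h2 : ∑ x : V × V, t x = A i j * (A * (A * A)) j i := by
      simp only [t, Fintype.sum_prod_type, Matrix.mul_apply, Finset.mul_sum, mul_assoc]
    rw [h1, h2, hcube]
    have := φ.adjMatrix_mul_swap hij.symm
    rw [← hAdef] at this
    push_cast
    linear_combination (D : ℂ) ^ 2 * this
  -- The terms `1 - Re t` are nonnegative while their sum `deg j · deg i - D²` is at most zero, so
  -- each of them vanishes.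
  have hre : ∑ x ∈ G.neighborFinset j ×ˢ G.neighborFinset i, (1 - (t x).re) =
      (G.degree j * G.degree i : ℝ) - D ^ 2 := by
    rw [sum_sub_distrib, ← Complex.re_sum, hsum]
    have : ((D : ℂ) ^ 2).re = (D : ℝ) ^ 2 := by norm_cast
    simp [this]
  have hnn : ∀ x ∈ G.neighborFinset j ×ˢ G.neighborFinset i, 0 ≤ 1 - (t x).re := fun x _ => by
    linarith [Complex.re_le_norm (t x), htle x]
  have hge : (D : ℝ) ^ 2 ≤ G.degree j * G.degree i := by
    linarith [Finset.sum_nonneg hnn]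
  have hdi := G.degree_le_maxDegree i
  have hdj := G.degree_le_maxDegree j
  have hge' : D ^ 2 ≤ G.degree j * G.degree i := by exact_mod_cast hge
  have hDpos : 0 < D := lt_of_lt_of_le ((G.degree_pos_iff_exists_adj i).mpr ⟨j, hij.symm⟩) hdi
  have hi : G.degree i = D := le_antisymm hdi (by nlinarith)
  have hj : G.degree j = D := le_antisymm hdj (by nlinarith)
  refine ⟨hi, hj, fun k l hk hl => ?_⟩
  have hzero : ∑ x ∈ G.neighborFinset j ×ˢ G.neighborFinset i, (1 - (t x).re) = 0 := by
    rw [hre, hi, hj]; ring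
  have hkl := (Finset.sum_eq_zero_iff_of_nonneg hnn).mp hzero (k, l) (by simp [hk, hl.symm])
  have hre1 : (t (k, l)).re = 1 := by linarith
  have ht1 : t (k, l) = 1 := by
    have h1 := htle (k, l)
    have h2 : (t (k, l)).re ^ 2 + (t (k, l)).im ^ 2 ≤ 1 := by
      have := Complex.sq_norm (t (k, l))
      rw [Complex.normSq_apply] at this
      nlinarith [norm_nonneg (t (k, l))]
    rw [hre1] at h2
    exact Complex.ext hre1 (by simpa using (by nlinarith : (t (k, l)).im ^ 2 = 0))
  refine ⟨?_, ?_⟩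
  · by_contra hna
    simp [t, hAdef, φ.adjMatrix_apply_of_not_adj hna] at ht1
  · have h1 := φ.adjMatrix_mul_swap hij
    rw [← hAdef] at h1
    simp only [t] at ht1
    linear_combination A j i * ht1 - A j k * A k l * A l i * h1

end

/-! ### Switching to the constant gain -/

theorem one_pullback_adjMatrix {V W : Type*} {G : SimpleGraph V} [DecidableRel G.Adj]
    {H : SimpleGraph W} (e : G ≃g H) (p q : V) :
    ((one H).pullback e).adjMatrix p q = if G.Adj p q then 1 else 0 := by
  simp [adjMatrix, pullback, one]

section

variable {V : Type*} [Fintype V] [DecidableEq V] {G : SimpleGraph V} [DecidableRel G.Adj]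

theorem switchingEquiv_of_apply {φ ψ : UnitGain G} (u : V → ℂ) (hu : ∀ p, ‖u p‖ = 1)
    (h : ∀ p q, ψ.adjMatrix p q = u p * φ.adjMatrix p q * star (u q)) :
    SwitchingEquiv φ ψ := by
  refine ⟨Matrix.diagonal u, isDiag_diagonal u, ?_, ?_⟩
  · rw [Matrix.mem_unitaryGroup_iff, star_eq_conjTranspose, diagonal_conjTranspose,
      diagonal_mul_diagonal, ← diagonal_one]
    congr 1
    ext p
    have := Complex.mul_conj' (u p)
    rw [hu p] at this
    simpa using this
  · ext p q
    rw [diagonal_conjTranspose, mul_diagonal, diagonal_mul, h]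
    rfl

theorem switchingIso_of_cube_eq (hconn : G.Connected) (φ : UnitGain G) {i j : V}
    (hij : G.Adj j i)
    (hcube : (φ.adjMatrix * (φ.adjMatrix * φ.adjMatrix)) j i =
      ((G.maxDegree : ℝ) : ℂ) ^ 2 * φ.adjMatrix j i) :
    SwitchingIso φ (one (completeBipartiteGraph (Fin G.maxDegree) (Fin G.maxDegree))) := by
  obtain ⟨hi, hj, hw⟩ := φ.walk_of_cube_eq hij hcube
  set D := G.maxDegree with hD
  set X := G.neighborFinset i with hX
  set Y := G.neighborFinset j with hY
  have hcX : X.card = D := by rw [hX, G.card_neighborFinset_eq_degree, hi]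
  have hcY : Y.card = D := by rw [hY, G.card_neighborFinset_eq_degree, hj]
  have mX : ∀ p, p ∈ X ↔ G.Adj i p := fun p => G.mem_neighborFinset i p
  have mY : ∀ p, p ∈ Y ↔ G.Adj j p := fun p => G.mem_neighborFinset j p
  have hkl : ∀ k ∈ Y, ∀ l ∈ X, G.Adj k l := fun k hk l hl =>
    (hw k l ((mY k).mp hk) ((mX l).mp hl).symm).1
  -- `k` is already adjacent to the `D` vertices of `X`, and no degree exceeds `D`.
  have nY : ∀ k ∈ Y, G.neighborFinset k = X := fun k hk => by
    refine (Finset.eq_of_subset_of_card_le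
      (fun l hl => (G.mem_neighborFinset k l).mpr (hkl k hk l hl)) ?_).symm
    rw [hcX, G.card_neighborFinset_eq_degree]
    exact G.degree_le_maxDegree k
  have nX : ∀ l ∈ X, G.neighborFinset l = Y := fun l hl => by
    refine (Finset.eq_of_subset_of_card_le
      (fun k hk => (G.mem_neighborFinset l k).mpr (hkl k hk l hl).symm) ?_).symm
    rw [hcY, G.card_neighborFinset_eq_degree]
    exact G.degree_le_maxDegree l
  -- `X ∪ Y` contains `i` and is closed under adjacency.
  have hcover : ∀ p, p ∈ X ∨ p ∈ Y := by
    intro p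
    have hr := hconn.preconnected i p
    rw [SimpleGraph.reachable_iff_reflTransGen] at hr
    induction hr with
    | refl => exact Or.inr ((mY i).mpr hij)
    | tail _ h ih =>
      rcases ih with ih | ih
      · right; rw [← nX _ ih]; exact (G.mem_neighborFinset _ _).mpr h
      · left; rw [← nY _ ih]; exact (G.mem_neighborFinset _ _).mpr h
  have hdisj : ∀ p, p ∈ X → p ∉ Y := fun p hp hq => G.loopless.irrefl p (hkl p hq p hp)
  have hYX : ∀ p, p ∉ X ↔ p ∈ Y := fun p =>
    ⟨fun h => (hcover p).resolve_left h, fun h h' => hdisj p h' h⟩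
  have hadj : ∀ p q, G.Adj p q ↔ (p ∈ X ∧ q ∉ X ∨ p ∉ X ∧ q ∈ X) := by
    intro p q
    rw [← G.mem_neighborFinset]
    rcases hcover p with hp | hp
    · rw [nX p hp, hYX, hYX]
      have := hdisj p hp
      tauto
    · rw [nY p hp, hYX, hYX]
      have : p ∉ X := (hYX p).mpr hp
      tauto
  have hXc : Xᶜ.card = D := by
    rw [← hcY]; congr 1; ext p; rw [mem_compl, hYX]
  obtain ⟨e⟩ := SimpleGraph.nonempty_iso_completeBipartiteGraph hadj hcX hXc
  refine ⟨e, ?_⟩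
  set A := φ.adjMatrix with hA
  have hnorm : ∀ {p q}, G.Adj p q → ‖A p q‖ = 1 := fun h => φ.norm_adjMatrix_of_adj h
  have hstar : ∀ p q, star (A p q) = A q p := φ.star_adjMatrix
  have hswap : ∀ {p q}, G.Adj p q → A p q * A q p = 1 := fun h => φ.adjMatrix_mul_swap h
  -- The gain of a walk from `i` to `p`: the edge itself on `X`, the detour through `j` on `Y`.
  -- Switching by `u` turns the gain of an edge into that of a closed walk `i, l, k, j, i`, which is
  -- `1`.
  let u : V → ℂ := fun p => if p ∈ X then A i p else A i j * A j p
  have huX : ∀ p ∈ X, u p = A i p := fun p hp => by simp [u, hp]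
  have huY : ∀ p ∈ Y, u p = A i j * A j p := fun p hp => by simp [u, (hYX p).mpr hp]
  have hXY : ∀ l ∈ X, ∀ k ∈ Y, u l * A l k * star (u k) = 1 := by
    intro l hl k hk
    have h1 := (hw k l ((mY k).mp hk) ((mX l).mp hl).symm).2
    have h2 := congrArg star h1
    simp only [star_mul', hstar] at h2
    rw [huX l hl, huY k hk, star_mul', hstar, hstar]
    have h3 := hswap hij.symm
    linear_combination A j i * h2 + h3
  refine switchingEquiv_of_apply u (fun p => ?_) (fun p q => ?_)
  · rcases hcover p with hp | hp
    · rw [huX p hp]; exact hnorm ((mX p).mp hp)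
    · rw [huY p hp, norm_mul, hnorm hij.symm, hnorm ((mY p).mp hp), one_mul]
  · rw [one_pullback_adjMatrix, ← hA]
    split_ifs with h
    · rcases (hadj p q).mp h with ⟨hp, hq⟩ | ⟨hp, hq⟩
      · exact (hXY p hp q ((hYX q).mp hq)).symm
      · have := congrArg star (hXY q hq p ((hYX p).mp hp))
        simp only [star_mul', hstar, star_star, star_one] at this
        linear_combination -this
    · simp [hA, φ.adjMatrix_apply_of_not_adj h]

/-- In block form, the all-ones block satisfies `J² = dJ`, hence `J³ = d²J`. -/
theorem one_pullback_cube {V : Type*} [Fintype V] {G : SimpleGraph V} [DecidableRel G.Adj]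
    {d : ℕ} (e : G ≃g completeBipartiteGraph (Fin d) (Fin d)) :
    let B := ((one (completeBipartiteGraph (Fin d) (Fin d))).pullback e).adjMatrix
    B * B * B = ((d : ℝ) ^ 2) • B := by
  intro B
  let J : Matrix (Fin d) (Fin d) ℂ := Matrix.of fun _ _ => 1
  have hJ : J * J = (d : ℝ) • J := by
    ext a b
    simp [J, Matrix.mul_apply]
  have hB : B = (Matrix.fromBlocks 0 J J 0).submatrix e.toEquiv e.toEquiv := by
    ext p q
    have h1 : B p q = if G.Adj p q then 1 else 0 := one_pullback_adjMatrix e p q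
    have h2 := e.map_adj_iff (v := p) (w := q)
    rw [h1]
    change _ = Matrix.fromBlocks 0 J J 0 (e p) (e q)
    generalize e p = x at h2 ⊢
    generalize e q = y at h2 ⊢
    rcases x with a | a <;> rcases y with b | b <;> simp [J, ← h2]
  rw [hB, submatrix_mul_equiv, submatrix_mul_equiv, fromBlocks_multiply, fromBlocks_multiply]
  have h : (d : ℝ) ^ 2 • Matrix.fromBlocks 0 J J 0 =
      Matrix.fromBlocks 0 ((d : ℝ) ^ 2 • J) ((d : ℝ) ^ 2 • J) 0 := by
    simp [fromBlocks_smul]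
  change _ = ((d : ℝ) ^ 2 • Matrix.fromBlocks 0 J J 0).submatrix _ _
  rw [h]
  simp [hJ, smul_smul, sq]

theorem SwitchingEquiv.cube_eq {φ ψ : UnitGain G} (h : SwitchingEquiv φ ψ) {c : ℝ}
    (hψ : ψ.adjMatrix * ψ.adjMatrix * ψ.adjMatrix = c • ψ.adjMatrix) :
    φ.adjMatrix * φ.adjMatrix * φ.adjMatrix = c • φ.adjMatrix := by
  obtain ⟨U, -, hU, h⟩ := h
  have h1 : Uᴴ * U = 1 := (Matrix.mem_unitaryGroup_iff').mp hU
  have hφ : φ.adjMatrix = Uᴴ * ψ.adjMatrix * U := by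
    rw [h]
    calc φ.adjMatrix = (Uᴴ * U) * φ.adjMatrix * (Uᴴ * U) := by rw [h1]; simp
      _ = _ := by simp only [Matrix.mul_assoc]
  have hU' : U * Uᴴ = 1 := (Matrix.mem_unitaryGroup_iff).mp hU
  have hB := hψ
  set B := ψ.adjMatrix
  rw [hφ]
  calc Uᴴ * B * U * (Uᴴ * B * U) * (Uᴴ * B * U)
      = Uᴴ * B * (U * Uᴴ) * B * (U * Uᴴ) * B * U := by simp only [Matrix.mul_assoc]
    _ = Uᴴ * (B * B * B) * U := by rw [hU']; simp only [Matrix.mul_one, Matrix.mul_assoc]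
    _ = c • (Uᴴ * B * U) := by rw [hB]; simp

end

end UnitGain

theorem mainTheorem8 {V : Type*} [Fintype V] [DecidableEq V] (G : SimpleGraph V)
    [DecidableRel G.Adj] (hconn : G.Connected) (hedge : G.edgeSet.Nonempty) (φ : UnitGain G) :
    (∀ i : V, (G.degree i : ℝ) / (G.maxDegree : ℝ) ≤ φ.vertexEnergy i) ∧
    (∀ i : V, φ.vertexEnergy i = (G.degree i : ℝ) / (G.maxDegree : ℝ) ↔
      ∃ d : ℕ, UnitGain.SwitchingIso φ
        (UnitGain.one (completeBipartiteGraph (Fin d) (Fin d)))) := by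
  obtain ⟨a, b, hab⟩ : ∃ a b, G.Adj a b := by
    obtain ⟨s, hs⟩ := hedge
    induction s with
    | _ a b => exact ⟨a, b, hs⟩
  have hDpos : 0 < G.maxDegree :=
    lt_of_lt_of_le ((G.degree_pos_iff_exists_adj a).mpr ⟨b, hab⟩) (G.degree_le_maxDegree a)
  have hDpos' : (0 : ℝ) < G.maxDegree := by exact_mod_cast hDpos
  refine ⟨fun i => ?_, fun i => ⟨fun h => ?_, ?_⟩⟩
  · rw [div_le_iff₀' hDpos']
    exact φ.degree_le_maxDegree_mul_vertexEnergy i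
  · refine ⟨G.maxDegree, ?_⟩
    -- A neighbour of the given `i` is needed, and the edge `ab` need not contain `i`.
    have : Nontrivial V := ⟨a, b, hab.ne⟩
    obtain ⟨j, hj⟩ := hconn.preconnected.exists_adj_of_nontrivial i
    refine UnitGain.switchingIso_of_cube_eq hconn φ hj.symm ?_
    refine φ.adjMatrix_isHermitian.cube_apply_of_diag_eq_zero φ.sum_norm_adjMatrix_le ?_ j
    rw [φ.smul_absAdjMatrix_sub_diag, h]
    norm_cast
    field_simp
    simp
  · rintro ⟨d, e, he⟩
    have hdeg := SimpleGraph.degree_eq_of_iso_completeBipartiteGraph e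
    -- Regularity identifies the arbitrary `d` with the maximum degree; in particular `d > 0`.
    have hmax : G.maxDegree = d := le_antisymm
      (G.maxDegree_le_of_forall_degree_le d fun p => (hdeg p).le)
      (hdeg i ▸ G.degree_le_maxDegree i)
    have hsqrt := φ.adjMatrix_isHermitian.sqrt_eq_of_cube (hmax ▸ hDpos')
      (he.cube_eq (UnitGain.one_pullback_cube e))
    rw [UnitGain.vertexEnergy, UnitGain.absAdjMatrix, hsqrt, Matrix.smul_apply,
      φ.adjMatrix_sq_diag, hmax, Complex.smul_re, Complex.natCast_re, smul_eq_mul]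
    ring
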